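/- **Setting.** Consider the rank-$6$ quartic melonic $U(1)$ tensor field theory with gauge invariance, in momentum space, with mass $m>0$; fix $M>1$. The propagator is $C(\vec p)=\delta\big(\sum_{c}p_c\big)\,(|\vec p|^2+m^2)^{-1}$ for $\vec p=(p_1,\dots,p_6)\in\mathbb Z^6$, where $\delta$ is the Kronecker symbol. It is sliced by sharp cutoffs as $C_i=C\chi_i$, $i\ge 1$, where $\chi_1$ is the indicator function of $|\vec p|^2\le M^2$ and $\chi_i$, for $i\ge 2$, is the indicator function of $M^{2(i-1)}<|\vec p|^2\le M^{2i}$. A *Feynman graph* $\mathcal G$ (finite, connected or not) has as vertices quartic melonic bubbles. A bubble has a special color in $\{1,\dots,6\}$; for special color $1$ it is the invariant $$\sum_{\vec p,\vec p\,'}\bar\phi(p_1,p_2,\dots,p_6)\,\phi(p'_1,p_2,\dots,p_6)\,\bar\phi(p'_1,p'_2,\dots,p'_6)\,\phi(p_1,p'_2,\dots,p'_6),$$ and similarly for the other colors. The internal lines of $\mathcal G$ are Wick contractions of a $\phi$ with a $\bar\phi$; the uncontracted fields are the external half-lines. A *face* of color $c$ is a connected component of the graph whose nodes are the fields and whose edges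 are the lines and the color-$c$ pairings of fields inside the bubbles; it is internal if it contains no external half-line, and external otherwise. Each face carries a momentum in $\mathbb Z$, and the component $p^\ell_c$ of the momentum $\vec p^{\,\ell}$ of a line $\ell$ is the momentum of the face of color $c$ through $\ell$. A *subgraph* $\mathcal H$ is a set of lines of $\mathcal G$, with the vertices attached to them; its internal faces are the faces of $\mathcal G$ all of whose fields are ends of lines of $\mathcal H$. Let $L(\mathcal H)$ be its number of lines, $F(\mathcal H)$ its number of internal faces, and $R(\mathcal H)$ the rank of its incidence matrix $\epsilon_{\ell f}$ between lines and internal faces (nonzero iff $\ell$ belongs to $f$, and then $\pm1$ according to the relative orientation; with all lines oriented from $\phi$ to $\bar\phi$ and the faces oriented along them, every nonzero entry is $+1$). The *divergence degree* is $$\omega(\mathcal H)=-2L(\mathcal H)+F(\mathcal H)-R(\mathcal H).$$ A *scale attribution* with cutoff $\rho$ is a family $\mu=\{i_\ell\}$ of integers $1\le i_\ell\le\rho$ indexed by the internal lines. For fixed momenta of the external faces, the (amputated) amplitude is $$\mathcal A_\mu(\mathcal G)=\sum_{(p_f)\in\mathbb Z^{F_{\mathrm{int}}(\mathcal G)}}\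 \prod_{\ell}C_{i_\ell}(\vec p^{\,\ell}),$$ where $F_{\mathrm{int}}(\mathcal G)$ is the set of internal faces of $\mathcal G$. For $1\le i\le\rho$ let $\mathcal G_i$ be the subgraph of the lines with $i_\ell\ge i$, and let $\mathcal G_i^1,\dots,\mathcal G_i^{k(i)}$ be its connected components (two lines being adjacent if they are attached to a common vertex). **Theorem.** For all $M>1$ and $m>0$ there is a constant $K>0$, depending only on $M$ and $m$, such that for every Feynman graph $\mathcal G$, every cutoff $\rho$, every scale attribution $\mu$ with cutoff $\rho$, and all momenta of the external faces, the sum defining $\mathcal A_\mu(\mathcal G)$ converges absolutely and $$|\mathcal A_\mu(\mathcal G)|\ \le\ K^{L(\mathcal G)}\prod_{i=1}^{\rho}\ \prod_{k=1}^{k(i)}M^{\omega(\mathcal G_i^k)} .$$ -/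

import Mathlib

/-! Feynman graphs, multiscale amplitudes and power counting for the quartic melonic `U(1)` tensor
group field theory of rank `6` with gauge invariance, in momentum space, with sharp cutoffs. -/

namespace TGFT

noncomputable section

/-- A Feynman graph with set of vertices `V` and set of internal lines `L`.

A vertex `v` is a quartic melonic bubble of special color `color v`. It carries two fields `φ`,
labelled `(v, false)` and `(v, true)`, and two fields `φ̄`, labelled likewise. An internal line is a
Wick contraction of a field `φ` (its source) with a field `φ̄` (its target), and each field is
contracted at most once. The fields that are not contracted are the external half-lines. The graph
need not be connected. -/
structure FeynmanGraph (V L : Type*) where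
  color : V → Fin 6
  src : L → V × Bool
  tgt : L → V × Bool
  src_injective : Function.Injective src
  tgt_injective : Function.Injective tgt

/-- The nodes of the edge-colored graph of a Feynman graph: one for each field `φ` (white) and one
for each field `φ̄` (black). -/
inductive Node (V : Type*) where
  | phi (h : V × Bool) : Node V
  | phiBar (h : V × Bool) : Node V

/-- `Node V` is two copies of `V × Bool`. -/
def nodeEquiv (V : Type*) : Node V ≃ (V × Bool) ⊕ (V × Bool) where
  toFun
    | .phi h => .inl h
    | .phiBar h => .inr h
  invFun
    | .inl h => .phi h
    | .inr h => .phiBar h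
  left_inv x := by cases x <;> rfl
  right_inv x := by cases x <;> rfl

instance (V : Type*) [Finite V] : Finite (Node V) := Finite.of_equiv _ (nodeEquiv V).symm

namespace FeynmanGraph

variable {V L : Type*} (G : FeynmanGraph V L)

/-- The field `φ` whose argument of color `c` is identified, inside the bubble, with the argument of
color `c` of the field `φ̄` labelled `h`. With special color `1`, the bubble is
`∑ φ̄(p₁,p₂,…,p₆) φ(p'₁,p₂,…,p₆) φ̄(p'₁,p'₂,…,p'₆) φ(p₁,p'₂,…,p'₆)`,
whose fields are, in this order, `φ̄` with label `false`, `φ` with label `false`, `φ̄` with label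
`true`, `φ` with label `true`. -/
def partner (c : Fin 6) (h : V × Bool) : V × Bool :=
  (h.1, if c = G.color h.1 then !h.2 else h.2)

/-- The edges of color `0` (the lines) and of color `c` of the edge-colored graph. -/
inductive BicoloredEdge (c : Fin 6) : Node V → Node V → Prop
  | line (l : L) : BicoloredEdge c (.phi (G.src l)) (.phiBar (G.tgt l))
  | strand (h : V × Bool) : BicoloredEdge c (.phiBar h) (.phi (G.partner c h))

/-- A face of color `c` is a connected component of the graph made of the edges of colors `0`
and `c`. -/
def Face : Type _ := Σ c : Fin 6, Quotient (Relation.EqvGen.setoid (G.BicoloredEdge c))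

/-- The face of color `c` through a node. -/
def faceOf (c : Fin 6) (x : Node V) : G.Face :=
  ⟨c, Quotient.mk (Relation.EqvGen.setoid (G.BicoloredEdge c)) x⟩

/-- The face to which the strand of color `c` of the line `l` belongs. -/
def strandFace (l : L) (c : Fin 6) : G.Face := G.faceOf c (.phi (G.src l))

/-- The node `x` is an end of the line `l`. -/
def IsEnd (l : L) (x : Node V) : Prop := x = .phi (G.src l) ∨ x = .phiBar (G.tgt l)

/-- A subgraph is a set `S` of lines, with the vertices attached to them. The face `f` is an internal
(closed) face of the subgraph if it meets no external half-line of it: every node of `f` is an end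
of a line of `S`. -/
def IsInternal (S : Set L) (f : G.Face) : Prop :=
  ∀ x : Node V, G.faceOf f.1 x = f → ∃ l ∈ S, G.IsEnd l x

/-- The internal faces of the subgraph `S`. -/
def InternalFace (S : Set L) : Type _ := {f : G.Face // G.IsInternal S f}

/-- The external (open) faces of the whole graph. -/
def ExternalFace : Type _ := {f : G.Face // ¬ G.IsInternal Set.univ f}

instance [Finite V] : Finite G.Face :=
  inferInstanceAs (Finite (Σ c : Fin 6, Quotient (Relation.EqvGen.setoid (G.BicoloredEdge c))))

instance [Finite V] (S : Set L) : Finite (G.InternalFace S) :=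
  inferInstanceAs (Finite {f : G.Face // G.IsInternal S f})

instance [Finite V] (S : Set L) : Fintype (G.InternalFace S) := Fintype.ofFinite _

open Classical in
/-- The line-face incidence matrix of the subgraph `S`. Every line is oriented from `φ` to `φ̄`, and
a face runs through all its lines in the same direction, so that all relative orientations
are `+1`. A line meets a face at most once, since its six strands have different colors. -/
def incidence (S : Set L) : Matrix S (G.InternalFace S) ℚ :=
  fun l f => if ∃ c, G.strandFace l.1 c = f.1 then 1 else 0

/-- The number `L(S)` of lines. -/
def numLines (_G : FeynmanGraph V L) (S : Set L) : ℕ := S.ncard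

/-- The number `F(S)` of internal faces. -/
def numFaces (S : Set L) : ℕ := Nat.card (G.InternalFace S)

/-- The rank `R(S)` of the incidence matrix. -/
def incidenceRank [Finite V] (S : Set L) : ℕ := (G.incidence S).rank

/-- The divergence degree `ω = -2L + F - R`. -/
def divDegree [Finite V] (S : Set L) : ℤ :=
  -2 * (G.numLines S : ℤ) + (G.numFaces S : ℤ) - (G.incidenceRank S : ℤ)

/-- The vertex `v` is attached to the line `l`. -/
def Attached (l : L) (v : V) : Prop := v = (G.src l).1 ∨ v = (G.tgt l).1

/-- Two different lines of `S` are adjacent if they are attached to a common vertex. -/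
def lineGraph (S : Set L) : SimpleGraph S where
  Adj a b := a ≠ b ∧ ∃ v, G.Attached a.1 v ∧ G.Attached b.1 v
  symm := ⟨fun _ _ h => ⟨h.1.symm, h.2.imp fun _ hv => ⟨hv.2, hv.1⟩⟩⟩
  loopless := ⟨fun _ h => h.1 rfl⟩

/-- The connected components of the subgraph `S`, each of them as a set of lines. -/
def components [Finite L] (S : Set L) : Finset (Set L) :=
  (Set.toFinite (Set.range fun k : (G.lineGraph S).ConnectedComponent =>
    ((↑) : S → L) '' k.supp)).toFinset

/-- The subgraph `G_i` of the lines of scale at least `i`. -/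
def highSubgraph (_G : FeynmanGraph V L) (μ : L → ℕ) (i : ℕ) : Set L := {l | i ≤ μ l}

open Classical in
/-- The momentum `(p₁,…,p₆)` of the line `l`, when the internal faces carry the momenta `p` and the
external faces carry the momenta `q`. -/
def lineMomentum (q : G.ExternalFace → ℤ) (p : G.InternalFace Set.univ → ℤ) (l : L) : Fin 6 → ℤ :=
  fun c => if h : G.IsInternal Set.univ (G.strandFace l c) then p ⟨_, h⟩ else q ⟨_, h⟩

end FeynmanGraph

/-- The squared Euclidean norm `|p|²` of a momentum. -/
def normSq (p : Fin 6 → ℤ) : ℝ := ∑ c, (p c : ℝ) ^ 2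

/-- The propagator `C(p) = δ(∑ p_c) / (|p|² + m²)`. -/
def propagator (m : ℝ) (p : Fin 6 → ℤ) : ℝ :=
  if ∑ c, p c = 0 then 1 / (normSq p + m ^ 2) else 0

open Classical in
/-- The sharp cutoff `χ_i` for `i ≥ 1`: the indicator function of `|p|² ≤ M²` for `i = 1`, and of
`M^(2(i-1)) < |p|² ≤ M^(2i)` for `i ≥ 2`. -/
def cutoff (M : ℝ) (i : ℕ) (p : Fin 6 → ℤ) : ℝ :=
  if normSq p ≤ M ^ (2 * i) ∧ (2 ≤ i → M ^ (2 * (i - 1)) < normSq p) then 1 else 0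

/-- The propagator `C_i` of scale `i`. -/
def slicedPropagator (M m : ℝ) (i : ℕ) (p : Fin 6 → ℤ) : ℝ := propagator m p * cutoff M i p

namespace FeynmanGraph

variable {V L : Type*} [Fintype L] (G : FeynmanGraph V L)

/-- The contribution to the amplitude of given momenta of the internal faces. -/
def integrand (M m : ℝ) (μ : L → ℕ) (q : G.ExternalFace → ℤ)
    (p : G.InternalFace Set.univ → ℤ) : ℝ :=
  ∏ l, slicedPropagator M m (μ l) (G.lineMomentum q p l)

/-- The (amputated) amplitude `A_μ(G)` with scale attribution `μ` and external momenta `q`, as the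
sum over the momenta of the internal faces. -/
def amplitude (M m : ℝ) (μ : L → ℕ) (q : G.ExternalFace → ℤ) : ℝ :=
  ∑' p : G.InternalFace Set.univ → ℤ, G.integrand M m μ q p

end FeynmanGraph

end

end TGFT

/-! The amplitude is at most the number of contributing momenta times the maximum of the integrand.
A line of scale `i` costs a constant times `M^(-2i)`. A closed face carries the momentum of each of
its lines, so its lowest line leaves it `O(M^j)` values, where `j` is the last scale at which the
face is closed. The conservation rules form a linear system whose matrix is the line-face incidence
matrix: if the columns of a family `B` of faces are independent, the momenta outside `B` determine
those in `B`, and only the former are counted. In particular finitely many momenta contribute,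
whence summability.

The point is to choose one `B` that is good at all scales. As the scale decreases the sets of closed
faces increase, and `exists_linearIndepOn_adapted_to_chain` extends a basis greedily from the
highest scale down. The faces of `B` closed in `G_i` then span all the columns of that subgraph, so
each component `H` contains at least `R(H)` of them (`incidenceRank_component_le`) and at most `F(H)
- R(H)` faces are free there. Writing each scale as a sum of ones over `1 ≤ i ≤ ρ` distributes the
exponent of `M` over the `G_i` and their components. -/

theorem prod_zpow_eq_zpow_sum {K ι : Type*} [Field K] {a : K} (ha : a ≠ 0) (t : Finset ι)
    (w : ι → ℤ) : ∏ x ∈ t, a ^ w x = a ^ ∑ x ∈ t, w x := by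
  induction t using Finset.cons_induction with
  | empty => simp
  | cons x t hx ih => rw [Finset.prod_cons, Finset.sum_cons, zpow_add₀ ha, ih]

/-- Along an increasing chain of sets of vectors, a linearly independent family can be chosen which
spans every set of the chain by its own members of that set. -/
theorem exists_linearIndepOn_adapted_to_chain {K E ι : Type*} [DivisionRing K] [AddCommGroup E]
    [Module K E] (v : ι → E) {t : ℕ → Set ι} (ht : Monotone t) (n : ℕ) :
    ∃ B ⊆ t n, LinearIndepOn K v B ∧
      ∀ j ≤ n, v '' t j ⊆ Submodule.span K (v '' (B ∩ t j)) := by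
  induction n with
  | zero =>
    obtain ⟨b, hb, -, hspan, hli⟩ :=
      exists_linearIndepOn_extension (linearIndepOn_empty K v) (Set.empty_subset (t 0))
    refine ⟨b, hb, hli, fun j hj => ?_⟩
    obtain rfl : j = 0 := by omega
    rwa [Set.inter_eq_left.2 hb]
  | succ n ih =>
    obtain ⟨B, hB, hli, hspan⟩ := ih
    obtain ⟨b, hb, hBb, hspan', hli'⟩ :=
      exists_linearIndepOn_extension hli (hB.trans (ht n.le_succ))
    refine ⟨b, hb, hli', fun j hj => ?_⟩
    rcases Nat.lt_or_ge n j with h | h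
    · obtain rfl : j = n + 1 := by omega
      rwa [Set.inter_eq_left.2 hb]
    · refine (hspan j h).trans (Submodule.span_mono (Set.image_mono ?_))
      exact Set.inter_subset_inter_left _ hBb

/-! ### Closed faces and the lines they run through -/

namespace TGFT

namespace FeynmanGraph

variable {V L : Type*} (G : FeynmanGraph V L)

/-- The internal faces of the subgraph `S`, as a set of faces of the whole graph. -/
def internalFaces (S : Set L) : Set G.Face := {f | G.IsInternal S f}

open Classical in
/-- The column of the face `f` in the line-face incidence matrix of the whole graph. -/
noncomputable def faceColumn (f : G.Face) (l : L) : ℚ := if ∃ c, G.strandFace l c = f then 1 else 0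

variable {G}

theorem IsInternal.mono {S T : Set L} (h : S ⊆ T) {f : G.Face} (hf : G.IsInternal S f) :
    G.IsInternal T f := fun x hx => (hf x hx).imp fun _ hl => ⟨h hl.1, hl.2⟩

theorem IsEnd.line_unique {l l' : L} {x : Node V} (h : G.IsEnd l x) (h' : G.IsEnd l' x) :
    l = l' := by
  rcases h with rfl | rfl <;> rcases h' with h' | h'
  · exact G.src_injective (Node.phi.inj h')
  · cases h'
  · cases h'
  · exact G.tgt_injective (Node.phiBar.inj h')

theorem faceOf_eq_iff {c : Fin 6} {x y : Node V} :
    G.faceOf c x = G.faceOf c y ↔ Relation.EqvGen (G.BicoloredEdge c) x y := by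
  unfold faceOf
  constructor
  · intro h
    exact Quotient.exact (eq_of_heq (Sigma.mk.inj h).2)
  · intro h
    exact congrArg (Sigma.mk c) (Quotient.sound h)

theorem IsEnd.faceOf_eq {l : L} {x : Node V} (h : G.IsEnd l x) (c : Fin 6) :
    G.faceOf c x = G.strandFace l c := by
  rcases h with rfl | rfl
  · rfl
  · exact faceOf_eq_iff.2 (.symm _ _ (.rel _ _ (.line l)))

theorem isEnd_src (l : L) : G.IsEnd l (.phi (G.src l)) := Or.inl rfl

theorem exists_faceOf_eq (f : G.Face) : ∃ x, G.faceOf f.1 x = f := by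
  obtain ⟨c, q⟩ := f
  induction q using Quotient.inductionOn with
  | h x => exact ⟨x, rfl⟩

theorem IsInternal.exists_strandFace_eq {S : Set L} {f : G.Face} (hf : G.IsInternal S f) :
    ∃ l ∈ S, G.strandFace l f.1 = f := by
  obtain ⟨x, hx⟩ := exists_faceOf_eq f
  obtain ⟨l, hl, he⟩ := hf x hx
  exact ⟨l, hl, (he.faceOf_eq _).symm.trans hx⟩

theorem IsInternal.mem_of_strandFace_eq {S : Set L} {f : G.Face} (hf : G.IsInternal S f) {l : L}
    {c : Fin 6} (h : G.strandFace l c = f) : l ∈ S := by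
  obtain rfl : c = f.1 := congrArg Sigma.fst h
  obtain ⟨l', hl', he⟩ := hf _ h
  rwa [(isEnd_src l).line_unique he]

theorem IsInternal.of_forall_mem {S T : Set L} {f : G.Face} (hf : G.IsInternal S f)
    (h : ∀ l, G.strandFace l f.1 = f → l ∈ T) : G.IsInternal T f := by
  intro x hx
  obtain ⟨l, -, he⟩ := hf x hx
  exact ⟨l, h l ((he.faceOf_eq _).symm.trans hx), he⟩

/-- A strand stays inside one bubble, so the lines at its two ends share a vertex. Internality
provides a line of `S` at every intermediate node of the path. -/
theorem reachable_of_eqvGen {S : Set L} {c : Fin 6} {x y : Node V}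
    (h : Relation.EqvGen (G.BicoloredEdge c) x y) :
    G.IsInternal S (G.faceOf c x) → ∀ a b : S, G.IsEnd a.1 x → G.IsEnd b.1 y →
      (G.lineGraph S).Reachable a b := by
  induction h with
  | rel x y h =>
    intro _ a b ha hb
    cases h with
    | line l =>
      obtain rfl : a = b := Subtype.ext <|
        (ha.line_unique (isEnd_src l)).trans
          (IsEnd.line_unique (x := .phiBar (G.tgt l)) (Or.inr rfl) hb)
      exact .refl _
    | strand h =>
      by_cases hab : a = b
      · exact hab ▸ .refl _
      refine SimpleGraph.Adj.reachable ⟨hab, h.1, ?_, ?_⟩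
      · rcases ha with ha | ha
        · cases ha
        · exact Or.inr (congrArg Prod.fst (Node.phiBar.inj ha))
      · rcases hb with hb | hb
        · exact Or.inl (show (G.partner c h).1 = _ from congrArg Prod.fst (Node.phi.inj hb))
        · cases hb
  | refl x =>
    intro _ a b ha hb
    obtain rfl : a = b := Subtype.ext (ha.line_unique hb)
    exact .refl _
  | symm x y h ih =>
    intro hf a b ha hb
    refine (ih ?_ b a hb ha).symm
    rwa [faceOf_eq_iff.2 h]
  | trans x y z hxy hyz ih₁ ih₂ =>
    intro hf a b ha hb
    have hy : G.faceOf c y = G.faceOf c x := (faceOf_eq_iff.2 hxy).symm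
    obtain ⟨l, hl, he⟩ := hf y hy
    exact (ih₁ hf a ⟨l, hl⟩ ha he).trans (ih₂ (hy ▸ hf) ⟨l, hl⟩ b he hb)

theorem IsInternal.reachable {S : Set L} {f : G.Face} (hf : G.IsInternal S f) {a b : S}
    (ha : G.strandFace a.1 f.1 = f) (hb : G.strandFace b.1 f.1 = f) :
    (G.lineGraph S).Reachable a b := by
  refine reachable_of_eqvGen (c := f.1) (faceOf_eq_iff.1 (ha.trans hb.symm)) ?_ a b
    (isEnd_src _) (isEnd_src _)
  exact ha.symm ▸ hf

/-! ### Power counting in the connected components of a subgraph -/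

section Components

variable [Finite L]

theorem mem_components {S H : Set L} :
    H ∈ G.components S ↔ ∃ k : (G.lineGraph S).ConnectedComponent,
      ((↑) : S → L) '' k.supp = H := by
  simp [components]

theorem subset_of_mem_components {S H : Set L} (hH : H ∈ G.components S) : H ⊆ S := by
  obtain ⟨k, rfl⟩ := mem_components.1 hH
  rintro _ ⟨l, -, rfl⟩
  exact l.2

theorem components_pairwiseDisjoint (S : Set L) :
    (G.components S : Set (Set L)).PairwiseDisjoint id := by
  intro H hH H' hH' hne
  obtain ⟨k, rfl⟩ := mem_components.1 hH
  obtain ⟨k', rfl⟩ := mem_components.1 hH'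
  refine Set.disjoint_left.2 ?_
  rintro _ ⟨l, hl, rfl⟩ ⟨l', hl', hll⟩
  obtain rfl : l' = l := Subtype.ext hll
  exact hne (by rw [← SimpleGraph.ConnectedComponent.mem_supp_iff _ _ |>.1 hl,
    ← SimpleGraph.ConnectedComponent.mem_supp_iff _ _ |>.1 hl'])

/-- A closed face that meets a connected component of a subgraph is contained in it. -/
theorem IsInternal.of_mem_component {S H : Set L} (hH : H ∈ G.components S) {f : G.Face}
    (hf : G.IsInternal S f) {l : L} (hl : l ∈ H) {c : Fin 6} (hlf : G.strandFace l c = f) :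
    G.IsInternal H f := by
  obtain rfl : c = f.1 := congrArg Sigma.fst hlf
  obtain ⟨k, rfl⟩ := mem_components.1 hH
  obtain ⟨a, ha, rfl⟩ := hl
  refine hf.of_forall_mem fun b hb => ⟨⟨b, hf.mem_of_strandFace_eq hb⟩, ?_, rfl⟩
  rw [SimpleGraph.ConnectedComponent.mem_supp_iff] at ha ⊢
  rw [← ha]
  exact SimpleGraph.ConnectedComponent.sound (hf.reachable (by exact hb) hlf)

theorem IsInternal.exists_component {S : Set L} {f : G.Face} (hf : G.IsInternal S f) :
    ∃ H ∈ G.components S, G.IsInternal H f := by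
  obtain ⟨l, hl, hlf⟩ := hf.exists_strandFace_eq
  have hH := mem_components.2 ⟨(G.lineGraph S).connectedComponentMk ⟨l, hl⟩, rfl⟩
  exact ⟨_, hH, hf.of_mem_component hH ⟨⟨l, hl⟩, rfl, rfl⟩ hlf⟩

theorem sum_ncard_components_le (S : Set L) :
    ∑ H ∈ G.components S, H.ncard ≤ S.ncard := by
  classical
  have := Fintype.ofFinite L
  simp_rw [Set.ncard_eq_toFinset_card']
  rw [← Finset.card_biUnion]
  · refine Finset.card_le_card (Finset.biUnion_subset.2 fun H hH => ?_)
    exact Set.toFinset_subset_toFinset.2 (subset_of_mem_components hH)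
  · intro H hH H' hH' hne
    exact Set.disjoint_toFinset.2 (components_pairwiseDisjoint S hH hH' hne)

theorem ncard_internalFaces_diff_le [Finite V] (S : Set L) (B : Set G.Face) :
    (G.internalFaces S \ B).ncard ≤
      ∑ H ∈ G.components S, (G.internalFaces H \ B).ncard := by
  classical
  have := Fintype.ofFinite G.Face
  simp_rw [Set.ncard_eq_toFinset_card']
  refine (Finset.card_le_card ?_).trans Finset.card_biUnion_le
  intro f hf
  rw [Set.mem_toFinset] at hf
  obtain ⟨H, hH, hfH⟩ := IsInternal.exists_component hf.1
  exact Finset.mem_biUnion.2 ⟨H, hH, Set.mem_toFinset.2 ⟨hfH, hf.2⟩⟩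

/-- Restricting the rows to `H` kills the columns of the closed faces of `S` that are not contained
in `H`, since these do not meet `H`. The columns of the faces of `B` internal to `H` therefore span
the column space of `H`. -/
theorem incidenceRank_component_le [Finite V] {S H : Set L} (hH : H ∈ G.components S)
    {B : Set G.Face}
    (hB : G.faceColumn '' G.internalFaces S ⊆
      Submodule.span ℚ (G.faceColumn '' (B ∩ G.internalFaces S))) :
    G.incidenceRank H ≤ (G.internalFaces H ∩ B).ncard := by
  classical
  let r : (L → ℚ) →ₗ[ℚ] (H → ℚ) := LinearMap.funLeft ℚ ℚ Subtype.val
  have := Fintype.ofFinite L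
  have := Fintype.ofFinite G.Face
  set W : Set (H → ℚ) := (fun f => r (G.faceColumn f)) '' (G.internalFaces H ∩ B) with hW
  have hspan : Submodule.span ℚ (Set.range (G.incidence H).col) ≤ Submodule.span ℚ W := by
    rw [Submodule.span_le]
    rintro _ ⟨f, rfl⟩
    have hcol : (G.incidence H).col f = r (G.faceColumn f.1) := rfl
    have hfS : f.1 ∈ G.internalFaces S := f.2.mono (subset_of_mem_components hH)
    have h₁ := Submodule.mem_map_of_mem (f := r) (hB ⟨_, hfS, rfl⟩)
    rw [Submodule.map_span] at h₁
    rw [hcol]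
    refine Submodule.span_le.2 ?_ h₁
    rintro _ ⟨_, ⟨g, ⟨hgB, hgS⟩, rfl⟩, rfl⟩
    by_cases hg : G.IsInternal H g
    · exact Submodule.subset_span ⟨g, ⟨hg, hgB⟩, rfl⟩
    · have : r (G.faceColumn g) = 0 := by
        funext l
        refine if_neg ?_
        rintro ⟨c, hc⟩
        exact hg (IsInternal.of_mem_component hH hgS l.2 hc)
      rw [this]
      exact Submodule.zero_mem _
  rw [incidenceRank, Matrix.rank_eq_finrank_span_cols]
  refine (Submodule.finrank_mono hspan).trans ((finrank_span_le_card W).trans ?_)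
  rw [← Set.ncard_eq_toFinset_card', hW]
  exact Set.ncard_image_le (Set.toFinite _)

theorem le_sum_divDegree_components [Finite V] {S : Set L} {B : Set G.Face}
    (hB : G.faceColumn '' G.internalFaces S ⊆
      Submodule.span ℚ (G.faceColumn '' (B ∩ G.internalFaces S))) :
    -2 * (S.ncard : ℤ) + ((G.internalFaces S \ B).ncard : ℤ) ≤
      ∑ H ∈ G.components S, G.divDegree H := by
  have h₁ : ∀ H ∈ G.components S,
      -2 * (H.ncard : ℤ) + ((G.internalFaces H \ B).ncard : ℤ) ≤ G.divDegree H := by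
    intro H hH
    have hr := incidenceRank_component_le hH hB
    have hF : G.numFaces H = (G.internalFaces H).ncard := rfl
    have hs := Set.ncard_inter_add_ncard_sdiff_eq_ncard (G.internalFaces H) B (Set.toFinite _)
    have hL : G.numLines H = H.ncard := rfl
    unfold divDegree
    omega
  have h₂ := Finset.sum_le_sum h₁
  rw [Finset.sum_add_distrib, ← Finset.mul_sum] at h₂
  have h₃ := sum_ncard_components_le (G := G) S
  have h₄ := ncard_internalFaces_diff_le S B
  zify at h₃ h₄
  linarith

end Components

/-! ### Summation over the scales -/

theorem exists_linearIndepOn_internalFaces (G : FeynmanGraph V L) (μ : L → ℕ) (ρ : ℕ) :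
    ∃ B : Set G.Face, LinearIndepOn ℚ G.faceColumn B ∧
      ∀ i ≤ ρ, G.faceColumn '' G.internalFaces (G.highSubgraph μ i) ⊆
        Submodule.span ℚ (G.faceColumn '' (B ∩ G.internalFaces (G.highSubgraph μ i))) := by
  -- The index is reversed: the chain starts at the highest scale `ρ`, where the fewest faces are
  -- closed.
  have ht : Monotone fun j => G.internalFaces (G.highSubgraph μ (ρ - j)) := by
    intro j k hjk f hf
    refine IsInternal.mono (fun l (hl : ρ - j ≤ μ l) => ?_) hf
    change ρ - k ≤ μ l
    omega
  obtain ⟨B, -, hli, hspan⟩ := exists_linearIndepOn_adapted_to_chain (K := ℚ) G.faceColumn ht ρ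
  refine ⟨B, hli, fun i hi => ?_⟩
  have := hspan (ρ - i) (by omega)
  rwa [show ρ - (ρ - i) = i by omega] at this

open Classical in
/-- The largest scale at which the face `f` is still closed, as the number of the scales up to `ρ`
at which it is. -/
noncomputable def faceScale (μ : L → ℕ) (ρ : ℕ) (f : G.Face) : ℕ :=
  ((Finset.Icc 1 ρ).filter fun i => G.IsInternal (G.highSubgraph μ i) f).card

theorem IsInternal.exists_line_le_faceScale {μ : L → ℕ} {ρ : ℕ} (hμ : ∀ l, 1 ≤ μ l ∧ μ l ≤ ρ)
    {f : G.Face} (hf : G.IsInternal Set.univ f) :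
    ∃ l, G.strandFace l f.1 = f ∧ μ l ≤ G.faceScale μ ρ f := by
  classical
  obtain ⟨l₁, -, hl₁⟩ := hf.exists_strandFace_eq
  let A : Set L := {l | G.strandFace l f.1 = f}
  have hA : A.Nonempty := ⟨l₁, hl₁⟩
  -- The face stays closed up to the scale of its lowest line.
  let l := Function.argminOn μ A hA
  refine ⟨l, Function.argminOn_mem μ A hA, ?_⟩
  have hsub : Finset.Icc 1 (μ l) ⊆
      (Finset.Icc 1 ρ).filter fun i => G.IsInternal (G.highSubgraph μ i) f := by
    intro i hi
    rw [Finset.mem_Icc] at hi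
    refine Finset.mem_filter.2 ⟨Finset.mem_Icc.2 ⟨hi.1, hi.2.trans (hμ l).2⟩, ?_⟩
    refine hf.of_forall_mem fun l' hl' => hi.2.trans ?_
    exact Function.argminOn_le μ A hl'
  have hcard := Finset.card_le_card hsub
  rwa [Nat.card_Icc, Nat.add_sub_cancel] at hcard

theorem sum_ncard_internalFaces_diff [Finite V] (μ : L → ℕ) (ρ : ℕ) (B : Set G.Face)
    [DecidablePred (· ∈ B)] :
    ∑ i ∈ Finset.Icc 1 ρ, (G.internalFaces (G.highSubgraph μ i) \ B).ncard =
      ∑ f : G.InternalFace Set.univ, if f.1 ∈ B then 0 else G.faceScale μ ρ f.1 := by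
  classical
  have h : ∀ i, (G.internalFaces (G.highSubgraph μ i) \ B).ncard =
      ∑ f : G.InternalFace Set.univ,
        if f.1 ∉ B ∧ G.IsInternal (G.highSubgraph μ i) f.1 then 1 else 0 := by
    intro i
    have hinj : Function.Injective fun f : G.InternalFace Set.univ => f.1 :=
      Subtype.val_injective
    rw [← Finset.card_filter, ← Set.ncard_coe_finset, ← Set.ncard_image_of_injective _ hinj]
    congr 1
    ext f
    constructor
    · rintro ⟨hf, hfB⟩
      exact ⟨⟨f, hf.mono (Set.subset_univ _)⟩, by simpa using ⟨hfB, hf⟩, rfl⟩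
    · rintro ⟨f, hf, rfl⟩
      have := (Finset.mem_filter.1 hf).2
      exact ⟨this.2, this.1⟩
  simp_rw [h]
  rw [Finset.sum_comm]
  refine Finset.sum_congr rfl fun f _ => ?_
  split_ifs with hf
  · simp [hf]
  · simp [hf, faceScale]

theorem sum_ncard_highSubgraph [Fintype L] {μ : L → ℕ} {ρ : ℕ} (hμ : ∀ l, μ l ≤ ρ) :
    ∑ i ∈ Finset.Icc 1 ρ, (G.highSubgraph μ i).ncard = ∑ l, μ l := by
  classical
  have h : ∀ i, (G.highSubgraph μ i).ncard = ∑ l, if i ≤ μ l then 1 else 0 := by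
    intro i
    rw [← Finset.card_filter, ← Set.ncard_coe_finset]
    congr 1
    ext l
    simp [highSubgraph]
  simp_rw [h]
  rw [Finset.sum_comm]
  refine Finset.sum_congr rfl fun l _ => ?_
  rw [← Finset.card_filter]
  have : (Finset.Icc 1 ρ).filter (fun i => i ≤ μ l) = Finset.Icc 1 (μ l) := by
    ext i
    have := hμ l
    simp only [Finset.mem_filter, Finset.mem_Icc]
    omega
  rw [this, Nat.card_Icc, Nat.add_sub_cancel]

/-- A closed face is recovered from its color and any one of its lines. -/
theorem card_internalFace_le [Finite V] [Fintype L] :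
    Fintype.card (G.InternalFace Set.univ) ≤ 6 * Fintype.card L := by
  choose l _ hl using fun f : G.InternalFace Set.univ => f.2.exists_strandFace_eq
  have hinj : Function.Injective fun f : G.InternalFace Set.univ => (f.1.1, l f) := by
    intro f g hfg
    obtain ⟨h₁, h₂⟩ := Prod.mk.inj hfg
    exact Subtype.ext (by rw [← hl f, ← hl g, h₁, h₂])
  simpa using Fintype.card_le_of_injective _ hinj

/-! ### The momenta that contribute to an amplitude -/

theorem lineMomentum_of_strandFace_eq (q : G.ExternalFace → ℤ) (p : G.InternalFace Set.univ → ℤ)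
    {l : L} {c : Fin 6} {f : G.InternalFace Set.univ} (h : G.strandFace l c = f.1) :
    G.lineMomentum q p l c = p f := by
  obtain ⟨f, hf⟩ := f
  obtain rfl : G.strandFace l c = f := h
  exact dif_pos hf

variable (G) in
/-- The momenta of the internal faces that respect the conservation rules and the ultraviolet
cutoffs of all the lines. -/
def admissibleMomenta (M : ℝ) (μ : L → ℕ) (q : G.ExternalFace → ℤ) :
    Set (G.InternalFace Set.univ → ℤ) :=
  {p | ∀ l, ∑ c, G.lineMomentum q p l c = 0 ∧
    normSq (G.lineMomentum q p l) ≤ M ^ (2 * μ l)}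

theorem abs_le_of_mem_admissibleMomenta {M : ℝ} (hM : 1 < M) {μ : L → ℕ} {ρ : ℕ}
    (hμ : ∀ l, 1 ≤ μ l ∧ μ l ≤ ρ) {q : G.ExternalFace → ℤ} {p : G.InternalFace Set.univ → ℤ}
    (hp : p ∈ G.admissibleMomenta M μ q) (f : G.InternalFace Set.univ) :
    |p f| ≤ ⌊M ^ G.faceScale μ ρ f.1⌋ := by
  obtain ⟨l, hl, hle⟩ := f.2.exists_line_le_faceScale hμ
  have h₁ : (p f : ℝ) ^ 2 ≤ normSq (G.lineMomentum q p l) := by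
    rw [← lineMomentum_of_strandFace_eq q p hl]
    exact Finset.single_le_sum (f := fun c => (G.lineMomentum q p l c : ℝ) ^ 2)
      (fun _ _ => sq_nonneg _) (Finset.mem_univ f.1.1)
  have h₂ : |(p f : ℝ)| ≤ M ^ μ l := by
    refine abs_le_of_sq_le_sq (h₁.trans ((hp l).2.trans_eq ?_)) (by positivity)
    rw [← pow_mul, mul_comm]
  rw [Int.le_floor, Int.cast_abs]
  exact h₂.trans (pow_le_pow_right₀ hM.le hle)

/-- A face has a single color, so the six strands of a line lie in six different faces. This turns
momentum conservation into a linear relation between incidence columns. -/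
theorem sum_strandFace_eq [Fintype G.Face] (d : G.Face → ℚ) (l : L) :
    ∑ c, d (G.strandFace l c) = ∑ f, d f * G.faceColumn f l := by
  classical
  have hinj : Function.Injective (G.strandFace l) := fun c c' h => congrArg Sigma.fst h
  have h : ∀ f, d f * G.faceColumn f l =
      if f ∈ Finset.univ.map ⟨G.strandFace l, hinj⟩ then d f else 0 := by
    intro f
    simp [faceColumn]
  simp_rw [h]
  rw [Finset.sum_ite_mem, Finset.univ_inter, Finset.sum_map]
  rfl

/-- Momenta obeying the conservation rules are determined by those of the faces outside of a family
of faces whose incidence columns are linearly independent. -/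
theorem admissibleMomenta_ext [Finite V] {M : ℝ} {μ : L → ℕ} {q : G.ExternalFace → ℤ}
    {B : Set G.Face} (hB : LinearIndepOn ℚ G.faceColumn B) {p p' : G.InternalFace Set.univ → ℤ}
    (hp : p ∈ G.admissibleMomenta M μ q) (hp' : p' ∈ G.admissibleMomenta M μ q)
    (h : ∀ f, f.1 ∉ B → p f = p' f) : p = p' := by
  classical
  have := Fintype.ofFinite G.Face
  -- Both configurations have the same external momenta, so their difference vanishes on the
  -- external faces.
  let d : G.Face → ℚ := fun f =>
    if hf : G.IsInternal Set.univ f then ((p ⟨f, hf⟩ : ℚ) - p' ⟨f, hf⟩) else 0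
  have hsum : ∑ f, d f • G.faceColumn f = 0 := by
    funext l
    rw [Finset.sum_apply]
    simp only [Pi.smul_apply, smul_eq_mul, Pi.zero_apply]
    rw [← sum_strandFace_eq]
    have hd : ∀ c, d (G.strandFace l c) =
        ((G.lineMomentum q p l c - G.lineMomentum q p' l c : ℤ) : ℚ) := by
      intro c
      by_cases hf : G.IsInternal Set.univ (G.strandFace l c)
      · simp [d, lineMomentum, hf]
      · simp [d, lineMomentum, hf]
    simp_rw [hd]
    rw [← Int.cast_sum, Finset.sum_sub_distrib, (hp l).1, (hp' l).1, sub_zero, Int.cast_zero]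
  have hzero : ∀ f ∉ B, d f = 0 := by
    intro f hf
    by_cases hi : G.IsInternal Set.univ f
    · simp [d, hi, h ⟨f, hi⟩ hf]
    · simp [d, hi]
  have hall : ∀ f ∈ B, d f = 0 := by
    intro f hf
    refine linearIndepOn_iff'.1 hB B.toFinset d (by simp) ?_ f (by simpa using hf)
    rw [← hsum]
    refine Finset.sum_subset (Finset.subset_univ _) fun f _ hf => ?_
    rw [hzero f (by simpa using hf), zero_smul]
  funext f
  have hf : d f.1 = 0 := by
    by_cases hfB : f.1 ∈ B
    · exact hall _ hfB
    · exact hzero _ hfB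
  have hf' : d f.1 = (p f : ℚ) - p' f := dif_pos f.2
  rw [hf'] at hf
  exact_mod_cast sub_eq_zero.1 hf

theorem finite_admissibleMomenta_and_ncard_le [Finite V] {M : ℝ} (hM : 1 < M) {μ : L → ℕ} {ρ : ℕ}
    (hμ : ∀ l, 1 ≤ μ l ∧ μ l ≤ ρ) (q : G.ExternalFace → ℤ) {B : Set G.Face}
    [DecidablePred (· ∈ B)] (hB : LinearIndepOn ℚ G.faceColumn B) :
    (G.admissibleMomenta M μ q).Finite ∧
      ((G.admissibleMomenta M μ q).ncard : ℝ) ≤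
        3 ^ Fintype.card (G.InternalFace Set.univ) *
          M ^ ∑ f : G.InternalFace Set.univ, if f.1 ∈ B then 0 else G.faceScale μ ρ f.1 := by
  classical
  let N : G.InternalFace Set.univ → ℤ := fun f => ⌊M ^ G.faceScale μ ρ f.1⌋
  let P : Finset (G.InternalFace Set.univ → ℤ) :=
    Fintype.piFinset fun f => if f.1 ∈ B then {0} else Finset.Icc (-N f) (N f)
  -- Forgetting the momenta in `B` loses nothing on admissible momenta.
  let π : (G.InternalFace Set.univ → ℤ) → G.InternalFace Set.univ → ℤ :=
    fun p f => if f.1 ∈ B then 0 else p f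
  have hmaps : Set.MapsTo π (G.admissibleMomenta M μ q) P := by
    intro p hp
    refine Finset.mem_coe.2 (Fintype.mem_piFinset.2 fun f => ?_)
    by_cases hf : f.1 ∈ B
    · simp [π, hf]
    · simpa [π, hf] using abs_le.1 (abs_le_of_mem_admissibleMomenta hM hμ hp f)
  have hinj : Set.InjOn π (G.admissibleMomenta M μ q) := by
    intro p hp p' hp' h
    refine admissibleMomenta_ext hB hp hp' fun f hf => ?_
    simpa [π, hf] using congrFun h f
  refine ⟨Set.Finite.of_injOn hmaps hinj P.finite_toSet, ?_⟩
  have hcard := Set.ncard_le_ncard_of_injOn π hmaps hinj P.finite_toSet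
  rw [Set.ncard_coe_finset, Fintype.card_piFinset] at hcard
  refine (Nat.cast_le.2 hcard).trans ?_
  rw [Nat.cast_prod, ← Finset.prod_pow_eq_pow_sum, ← Finset.card_univ, ← Finset.prod_const,
    ← Finset.prod_mul_distrib]
  refine Finset.prod_le_prod (fun _ _ => Nat.cast_nonneg _) fun f _ => ?_
  split_ifs with hf
  · simp
  · have h₁ : (1 : ℝ) ≤ M ^ G.faceScale μ ρ f.1 := one_le_pow₀ hM.le
    have h₂ : (N f : ℝ) ≤ M ^ G.faceScale μ ρ f.1 := Int.floor_le _
    have h₃ : 0 ≤ N f := Int.floor_nonneg.2 (zero_le_one.trans h₁)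
    rw [Int.card_Icc]
    have h₄ : (((N f + 1 - -N f).toNat : ℕ) : ℝ) = 2 * N f + 1 := by
      rw [← Int.cast_natCast, Int.toNat_of_nonneg (by omega)]
      push_cast
      ring
    rw [h₄]
    -- `2N + 1 ≤ 3 M^j`, because `N ≤ M^j` and `1 ≤ M^j`: a factor `3` per face.
    linarith

/-! ### Bounds on the propagators -/

/-- For `i ≥ 2` the lower cutoff gives the decay, and `M ^ 2` pays for the shift from `i - 1` to
`i`. The first slice has no lower cutoff, and only the mass bounds the propagator there. -/
theorem abs_slicedPropagator_le {M m : ℝ} (hM : 1 < M) (hm : 0 < m) {i : ℕ} (hi : 1 ≤ i)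
    (p : Fin 6 → ℤ) :
    |slicedPropagator M m i p| ≤ M ^ 2 * max 1 (1 / m ^ 2) * (M ^ (2 * i))⁻¹ := by
  have hM0 : 0 < M := zero_lt_one.trans hM
  have hn : 0 ≤ normSq p := Finset.sum_nonneg fun _ _ => sq_nonneg _
  have hmax : (0 : ℝ) < max 1 (1 / m ^ 2) := lt_max_of_lt_left one_pos
  unfold slicedPropagator propagator cutoff
  split_ifs with h₁ h₂ h₂
  · rw [mul_one, abs_of_nonneg (by positivity)]
    rcases Nat.lt_or_ge i 2 with h | h
    · obtain rfl : i = 1 := by omega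
      have : M ^ 2 * max 1 (1 / m ^ 2) * (M ^ (2 * 1))⁻¹ = max 1 (1 / m ^ 2) := by
        field_simp
      rw [this]
      refine le_max_of_le_right (one_div_le_one_div_of_le (by positivity) ?_)
      linarith
    · have h₃ := h₂.2 h
      have h₄ : M ^ 2 * (M ^ (2 * i))⁻¹ = 1 / M ^ (2 * (i - 1)) := by
        have : M ^ (2 * i) = M ^ 2 * M ^ (2 * (i - 1)) := by
          rw [← pow_add]
          congr 1
          omega
        rw [this]
        field_simp
      calc 1 / (normSq p + m ^ 2) ≤ 1 / M ^ (2 * (i - 1)) :=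
            one_div_le_one_div_of_le (by positivity) (by nlinarith)
        _ = M ^ 2 * (M ^ (2 * i))⁻¹ * 1 := by rw [h₄, mul_one]
        _ ≤ M ^ 2 * (M ^ (2 * i))⁻¹ * max 1 (1 / m ^ 2) := by
            gcongr
            exact le_max_left _ _
        _ = _ := by ring
  all_goals
    simp only [mul_zero, zero_mul, abs_zero]
    positivity

theorem sum_eq_zero_of_slicedPropagator_ne_zero {M m : ℝ} {i : ℕ} {p : Fin 6 → ℤ}
    (h : slicedPropagator M m i p ≠ 0) : ∑ c, p c = 0 ∧ normSq p ≤ M ^ (2 * i) := by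
  unfold slicedPropagator propagator cutoff at h
  split_ifs at h with h₁ h₂
  · exact ⟨h₁, h₂.1⟩
  all_goals simp at h

variable [Fintype L]

theorem support_integrand_subset (M m : ℝ) (μ : L → ℕ) (q : G.ExternalFace → ℤ) :
    Function.support (G.integrand M m μ q) ⊆ G.admissibleMomenta M μ q := fun _ hp l =>
  sum_eq_zero_of_slicedPropagator_ne_zero (Finset.prod_ne_zero_iff.1 hp l (Finset.mem_univ l))

theorem abs_integrand_le {M m : ℝ} (hM : 1 < M) (hm : 0 < m) {μ : L → ℕ} (hμ : ∀ l, 1 ≤ μ l)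
    (q : G.ExternalFace → ℤ) (p : G.InternalFace Set.univ → ℤ) :
    |G.integrand M m μ q p| ≤
      (M ^ 2 * max 1 (1 / m ^ 2)) ^ Fintype.card L * (M ^ (2 * ∑ l, μ l))⁻¹ := by
  unfold integrand
  rw [Finset.abs_prod, Finset.mul_sum, ← Finset.prod_pow_eq_pow_sum, ← Finset.card_univ,
    ← Finset.prod_const, ← Finset.prod_inv_distrib, ← Finset.prod_mul_distrib]
  exact Finset.prod_le_prod (fun _ _ => abs_nonneg _) fun l _ =>
    abs_slicedPropagator_le hM hm (hμ l) _

end FeynmanGraph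

end TGFT

/-! ### The power-counting bound -/

theorem mainTheorem4 (M m : ℝ) (hM : 1 < M) (hm : 0 < m) :
    ∃ K : ℝ, 0 < K ∧
      ∀ (V L : Type*) [Fintype V] [Fintype L] (G : TGFT.FeynmanGraph V L)
        (ρ : ℕ) (μ : L → ℕ), (∀ l, 1 ≤ μ l ∧ μ l ≤ ρ) →
        ∀ q : G.ExternalFace → ℤ,
          Summable (G.integrand M m μ q) ∧
          |G.amplitude M m μ q| ≤
            K ^ G.numLines Set.univ *
              ∏ i ∈ Finset.Icc 1 ρ, ∏ H ∈ G.components (G.highSubgraph μ i),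
                M ^ G.divDegree H := by
  classical
  have hM0 : 0 < M := zero_lt_one.trans hM
  have hmax : (0 : ℝ) < max 1 (1 / m ^ 2) := lt_max_of_lt_left one_pos
  -- There are at most six closed faces per line, each with a factor `3`; the rest is the constant
  -- of the propagator bound.
  refine ⟨3 ^ 6 * (M ^ 2 * max 1 (1 / m ^ 2)), by positivity, ?_⟩
  intro V L _ _ G ρ μ hμ q
  obtain ⟨B, hli, hspan⟩ := G.exists_linearIndepOn_internalFaces μ ρ
  obtain ⟨hfin, hcard⟩ :=
    TGFT.FeynmanGraph.finite_admissibleMomenta_and_ncard_le hM hμ q hli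
  have hsupp := TGFT.FeynmanGraph.support_integrand_subset (G := G) M m μ q
  refine ⟨summable_of_hasFiniteSupport (hfin.subset hsupp), ?_⟩
  have hL : G.numLines Set.univ = Fintype.card L := by
    rw [TGFT.FeynmanGraph.numLines, Set.ncard_univ, Nat.card_eq_fintype_card]
  set s := ∑ f : G.InternalFace Set.univ,
    if f.1 ∈ B then 0 else TGFT.FeynmanGraph.faceScale μ ρ f.1 with hs
  have hdeg : -2 * ((∑ l, μ l : ℕ) : ℤ) + (s : ℤ) ≤
      ∑ i ∈ Finset.Icc 1 ρ, ∑ H ∈ G.components (G.highSubgraph μ i), G.divDegree H := by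
    rw [hs, ← TGFT.FeynmanGraph.sum_ncard_internalFaces_diff,
      ← TGFT.FeynmanGraph.sum_ncard_highSubgraph (G := G) fun l => (hμ l).2, Nat.cast_sum,
      Nat.cast_sum, Finset.mul_sum, ← Finset.sum_add_distrib]
    exact Finset.sum_le_sum fun i hi =>
      TGFT.FeynmanGraph.le_sum_divDegree_components (hspan i (Finset.mem_Icc.1 hi).2)
  have hprod : (M ^ (2 * ∑ l, μ l))⁻¹ * M ^ s ≤
      ∏ i ∈ Finset.Icc 1 ρ, ∏ H ∈ G.components (G.highSubgraph μ i), M ^ G.divDegree H := by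
    simp_rw [prod_zpow_eq_zpow_sum hM0.ne']
    refine le_trans (le_of_eq ?_) (zpow_le_zpow_right₀ hM.le hdeg)
    rw [zpow_add₀ hM0.ne', zpow_natCast, neg_mul, zpow_neg]
    norm_cast
  have hT : |G.amplitude M m μ q| ≤ (G.admissibleMomenta M μ q).ncard *
      ((M ^ 2 * max 1 (1 / m ^ 2)) ^ Fintype.card L * (M ^ (2 * ∑ l, μ l))⁻¹) := by
    rw [TGFT.FeynmanGraph.amplitude,
      tsum_eq_sum (s := hfin.toFinset) fun p hp => Function.notMem_support.1
        fun h => hp (hfin.mem_toFinset.2 (hsupp h))]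
    refine (Finset.abs_sum_le_sum_abs _ _).trans ?_
    rw [Set.ncard_eq_toFinset_card _ hfin, ← nsmul_eq_mul]
    exact Finset.sum_le_card_nsmul _ _ _ fun p _ =>
      TGFT.FeynmanGraph.abs_integrand_le hM hm (fun l => (hμ l).1) q p
  rw [hL]
  have h3 : (3 : ℝ) ^ Fintype.card (G.InternalFace Set.univ) ≤ (3 ^ 6) ^ Fintype.card L := by
    rw [← pow_mul]
    exact pow_le_pow_right₀ (by norm_num) TGFT.FeynmanGraph.card_internalFace_le
  calc |G.amplitude M m μ q|
      ≤ (3 ^ Fintype.card (G.InternalFace Set.univ) * M ^ s) *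
          ((M ^ 2 * max 1 (1 / m ^ 2)) ^ Fintype.card L * (M ^ (2 * ∑ l, μ l))⁻¹) :=
        hT.trans (by gcongr)
    _ ≤ ((3 ^ 6) ^ Fintype.card L * M ^ s) *
          ((M ^ 2 * max 1 (1 / m ^ 2)) ^ Fintype.card L * (M ^ (2 * ∑ l, μ l))⁻¹) := by
        gcongr
    _ = (3 ^ 6 * (M ^ 2 * max 1 (1 / m ^ 2))) ^ Fintype.card L *
          ((M ^ (2 * ∑ l, μ l))⁻¹ * M ^ s) := by
        rw [mul_pow (3 ^ 6 : ℝ)]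
        ring
    _ ≤ _ := by gcongr
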